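/- **Syntax.** Fix a countably infinite set of atomic propositions. Formulas of modal logic $\mathsf{ML}$ (letters $\alpha,\beta,\gamma$) are built from atomic propositions with $\neg$, $\to$, $\Box$; $\alpha\lor\beta$ abbreviates $\neg\alpha\to\beta$. Formulas of modal team logic $\mathsf{MTL}$ (letters $\varphi,\psi,\vartheta$) form the closure of $\mathsf{ML}$ under strong negation $\sim$, material implication $\rightarrowtriangle$, linear implication $\multimap$, and the unary modalities $\Box$, $\Delta$ (for $\alpha\in\mathsf{ML}$, the formula $\Box\alpha$ is the same whether built in $\mathsf{ML}$ or in $\mathsf{MTL}$). $\mathcal B(\mathsf{ML})\subseteq\mathsf{MTL}$ is the closure of $\mathsf{ML}$ under $\sim$ and $\rightarrowtriangle$ only. Abbreviate $\varphi\otimes\psi:=\ \sim(\varphi\multimap\sim\psi)$, $\Diamond\varphi:=\ \sim\Delta\sim\varphi$, and let $\varphi\leftrightarrowtriangle\psi$ be $\sim((\varphi\rightarrowtriangle\psi)\rightarrowtriangle\sim(\psi\rightarrowtriangle\varphi))$. **Semantics.** An $\mathsf{MTL}$ valuation is a pair $(K,T)$ of a Kripke structure $K=(W,R,V)$ and a team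 $T\subseteq W$. For $\alpha\in\mathsf{ML}$, $(K,T)\vDash\alpha$ iff $\alpha$ holds at every $w\in T$ in the usual Kripke semantics; $\sim$ and $\rightarrowtriangle$ are Boolean negation and implication; $(K,T)\vDash\varphi\multimap\psi$ iff for all $S,U$ with $S\cup U=T$, $(K,S)\vDash\varphi$ implies $(K,U)\vDash\psi$; $(K,T)\vDash\Box\varphi$ iff $(K,R[T])\vDash\varphi$, where $R[T]$ is the set of all successors of worlds in $T$; $(K,T)\vDash\Delta\varphi$ iff $(K,T')\vDash\varphi$ for every successor team $T'$ of $T$, i.e. every $T'$ such that each $w\in T$ has a successor in $T'$ and each $v\in T'$ has a predecessor in $T$. **Proof system.** $\mathsf{H}^\Box\mathsf{LSM}$ is the union of the following Hilbert systems over $\mathsf{MTL}$ formulas; derivations may use premises, and each rule marked (thm) may be applied only to theorems, i.e. to formulas derived without premises. * $\mathsf H^\Box$: axioms $\alpha\to(\beta\to\alpha)$; $(\alpha\to(\beta\to\gamma))\to((\alpha\to\beta)\to(\alpha\to\gamma))$; $(\neg\alpha\to\neg\beta)\to(\beta\to\alpha)$; $\Box(\alpha\to\beta)\to(\Box\alpha\to\Box\beta)$;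 rules: from $\alpha$ and $\alpha\to\beta$ infer $\beta$; from $\alpha$ infer $\Box\alpha$ (thm). * $\mathsf L$: axioms $\varphi\rightarrowtriangle(\psi\rightarrowtriangle\varphi)$; $(\varphi\rightarrowtriangle(\psi\rightarrowtriangle\vartheta))\rightarrowtriangle((\varphi\rightarrowtriangle\psi)\rightarrowtriangle(\varphi\rightarrowtriangle\vartheta))$; $(\sim\varphi\rightarrowtriangle\sim\psi)\rightarrowtriangle(\psi\rightarrowtriangle\varphi)$; $(\alpha\to\beta)\rightarrowtriangle(\alpha\rightarrowtriangle\beta)$; rule: from $\varphi$ and $\varphi\rightarrowtriangle\psi$ infer $\psi$. * $\mathsf S$: axioms $(\alpha\otimes\beta)\leftrightarrowtriangle(\alpha\lor\beta)$; $\alpha\rightarrowtriangle(\varphi\multimap\alpha)$; $\varphi\rightarrowtriangle((\varphi\multimap\psi)\rightarrowtriangle(\vartheta\multimap\psi))$; $(\varphi\multimap(\psi\multimap\vartheta))\rightarrowtriangle(\psi\multimap(\varphi\multimap\vartheta))$; $(\varphi\multimap\sim\psi)\rightarrowtriangle(\psi\multimap\sim\varphi)$; $(\varphi\multimap(\psi\rightarrowtriangle\vartheta))\rightarrowtriangle((\varphi\multimap\psi)\rightarrowtriangle(\varphi\multimap\vartheta))$;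 rule: from $\varphi$ infer $\psi\multimap\varphi$ (thm). * $\mathsf M$: axioms $\Box\sim\varphi\leftrightarrowtriangle\ \sim\Box\varphi$; $\Diamond\alpha\leftrightarrowtriangle\neg\Box\neg\alpha$; $\Diamond(\varphi\otimes\psi)\leftrightarrowtriangle(\Diamond\varphi\otimes\Diamond\psi)$; $\Box\alpha\rightarrowtriangle\Delta\alpha$; $\Diamond\varphi\rightarrowtriangle(\Delta\psi\rightarrowtriangle\Box\psi)$; $\Box(\varphi\rightarrowtriangle\psi)\rightarrowtriangle(\Box\varphi\rightarrowtriangle\Box\psi)$; $\Delta(\varphi\rightarrowtriangle\psi)\rightarrowtriangle(\Delta\varphi\rightarrowtriangle\Delta\psi)$; rules: from $\varphi$ infer $\Box\varphi$ (thm); from $\varphi$ infer $\Delta\varphi$ (thm). **Theorem.** For every $\mathsf{MTL}$ formula $\varphi$ there is a $\mathcal B(\mathsf{ML})$ formula $\varphi'$ such that $\{\varphi\}\vdash\varphi'$ and $\{\varphi'\}\vdash\varphi$ in $\mathsf{H}^\Box\mathsf{LSM}$, and such that $\varphi$ and $\varphi'$ are true in exactly the same valuations $(K,T)$. In particular $\mathsf{MTL}\equiv\mathcal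 B(\mathsf{ML})$: each formula of either logic has a formula of the other with the same models. -/

import Mathlib

universe u

namespace TeamLogic

/-! ### Formulas -/

/-- Formulas of modal logic `ML`, over the countably infinite set `ℕ` of atomic propositions. -/
inductive ML : Type
  | var : ℕ → ML
  | neg : ML → ML
  | imp : ML → ML → ML
  | box : ML → ML

/-- Classical disjunction `α ∨ β`, i.e. `¬α → β`. -/
def ML.or (α β : ML) : ML := (ML.neg α).imp β

/-- Formulas of modal team logic `MTL`: the closure of the `ML` formulas under strong negation `∼`
(`snot`), material implication (`mimp`), linear implication (`limp`), `□` (`box`) and `Δ` (`delta`).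
The classical connectives `¬` and `→` apply to `ML` formulas only. As formulas are words, `□α` with
`α` in `ML` is one and the same formula whether its `□` is read classically or as a team modality,
so there is only one `box` here; see `ML.toMTL` for the inclusion of `ML`. -/
inductive MTL : Type
  | var : ℕ → MTL
  | neg : ML → MTL
  | imp : ML → ML → MTL
  | snot : MTL → MTL
  | mimp : MTL → MTL → MTL
  | limp : MTL → MTL → MTL
  | box : MTL → MTL
  | delta : MTL → MTL

/-- Every `ML` formula is an `MTL` formula. -/
def ML.toMTL : ML → MTL
  | .var p => .var p
  | .neg α => .neg α
  | .imp α β => .imp α β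
  | .box α => .box α.toMTL

instance : Coe ML MTL := ⟨ML.toMTL⟩

/-- The inclusion of `ML` into `MTL` identifies no two formulas. -/
theorem ML.toMTL_injective : Function.Injective ML.toMTL := by
  intro α
  induction α with
  | var p => intro β h; cases β <;> simp_all [ML.toMTL]
  | neg α _ => intro β h; cases β <;> simp_all [ML.toMTL]
  | imp α β _ _ => intro β h; cases β <;> simp_all [ML.toMTL]
  | box α ih =>
    intro β h
    cases β with
    | box β => simp only [ML.toMTL, MTL.box.injEq] at h; rw [ih h]
    | _ => simp [ML.toMTL] at h

/-- `MTL` is the least set of formulas that contains `ML` and is closed under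
`∼`, `mimp`, `limp`, `□` and `Δ`. -/
theorem MTL.closure_induction {P : MTL → Prop} (ml : ∀ α : ML, P α)
    (snot : ∀ φ, P φ → P φ.snot) (mimp : ∀ φ ψ, P φ → P ψ → P (φ.mimp ψ))
    (limp : ∀ φ ψ, P φ → P ψ → P (φ.limp ψ)) (box : ∀ φ, P φ → P φ.box)
    (delta : ∀ φ, P φ → P φ.delta) (φ : MTL) : P φ := by
  induction φ with
  | var p => exact ml (.var p)
  | neg α => exact ml (.neg α)
  | imp α β => exact ml (.imp α β)
  | snot φ h => exact snot φ h
  | mimp φ ψ h h' => exact mimp φ ψ h h'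
  | limp φ ψ h h' => exact limp φ ψ h h'
  | box φ h => exact box φ h
  | delta φ h => exact delta φ h

/-- The fragment `B(ML)`: the closure of the `ML` formulas under `∼` and `mimp` only. -/
inductive IsBML : MTL → Prop
  | ml (α : ML) : IsBML α
  | snot {φ : MTL} : IsBML φ → IsBML φ.snot
  | mimp {φ ψ : MTL} : IsBML φ → IsBML ψ → IsBML (φ.mimp ψ)

/-- The set of `B(ML)` formulas. -/
def BML : Set MTL := {φ | IsBML φ}

local prefix:75 "∼" => MTL.snot
local infixr:30 " ⇛ " => MTL.mimp
local infixr:40 " ⊸ " => MTL.limp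
local prefix:75 "□" => MTL.box
local prefix:75 "▵" => MTL.delta

/-- Team-logical conjunction: `∼(φ ⇛ ∼ψ)`. -/
def MTL.and (φ ψ : MTL) : MTL := ∼(φ ⇛ ∼ψ)

/-- Team-logical equivalence: the conjunction of `φ ⇛ ψ` and `ψ ⇛ φ`. -/
def MTL.iff (φ ψ : MTL) : MTL := MTL.and (φ ⇛ ψ) (ψ ⇛ φ)

/-- Splitting disjunction `φ ⊗ ψ`: `∼(φ ⊸ ∼ψ)`. -/
def MTL.tensor (φ ψ : MTL) : MTL := ∼(φ ⊸ ∼ψ)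

/-- `◇φ`: `∼Δ∼φ`. -/
def MTL.dia (φ : MTL) : MTL := ∼(▵(∼φ))

local infix:25 " ⇔ " => MTL.iff
local infixl:50 " ⊗ " => MTL.tensor
local prefix:75 "◇" => MTL.dia

/-! ### Proof systems -/

/-- A Hilbert-style calculus over the formulas `F`: axioms, inference rules (finitely many premises
and a conclusion), and inference rules whose premises have to be theorems, i.e. have to be derived
from the axioms alone. -/
structure Calculus (F : Type) where
  axs : Set F
  rules : Set (List F × F)
  thmRules : Set (List F × F)

/-- The union of two calculi, component by component. -/
def Calculus.union {F : Type} (C D : Calculus F) : Calculus F where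
  axs := C.axs ∪ D.axs
  rules := C.rules ∪ D.rules
  thmRules := C.thmRules ∪ D.thmRules

/-- `C.Derives Φ φ`: the formula `φ` has a proof in `C` from the premises `Φ`. -/
inductive Calculus.Derives {F : Type} (C : Calculus F) : Set F → F → Prop
  | prem {Φ : Set F} {φ : F} : φ ∈ Φ → C.Derives Φ φ
  | ax {Φ : Set F} {φ : F} : φ ∈ C.axs → C.Derives Φ φ
  | rule {Φ : Set F} {ξs : List F} {φ : F} : (ξs, φ) ∈ C.rules →
      (∀ ξ ∈ ξs, C.Derives Φ ξ) → C.Derives Φ φ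
  | thmRule {Φ : Set F} {ξs : List F} {φ : F} : (ξs, φ) ∈ C.thmRules →
      (∀ ξ ∈ ξs, C.Derives ∅ ξ) → C.Derives Φ φ

/-- `φ ⊣⊢ ψ` in `C`: the two formulas prove each other. -/
def Calculus.ProvEquiv {F : Type} (C : Calculus F) (φ ψ : F) : Prop :=
  C.Derives {φ} ψ ∧ C.Derives {ψ} φ

/-! In the following systems `α β γ` are classical formulas and `φ ψ θ` arbitrary ones. -/

/-- Axioms (A1), (A2), (A3), (K) of `H□`. -/
inductive HBoxAxiom : MTL → Prop
  | a1 (α β : ML) : HBoxAxiom (α.imp (β.imp α) : ML)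
  | a2 (α β γ : ML) : HBoxAxiom
      ((α.imp (β.imp γ)).imp ((α.imp β).imp (α.imp γ)) : ML)
  | a3 (α β : ML) : HBoxAxiom ((α.neg.imp β.neg).imp (β.imp α) : ML)
  | k (α β : ML) : HBoxAxiom ((α.imp β).box.imp (α.box.imp β.box) : ML)

/-- The system `H□` of modal logic, with modus ponens for `→` and necessitation. -/
def HBox : Calculus MTL where
  axs := {φ | HBoxAxiom φ}
  rules := {r | ∃ α β : ML, r = ([(α : MTL), ((α.imp β : ML) : MTL)], (β : MTL))}
  thmRules := {r | ∃ α : ML, r = ([(α : MTL)], ((α.box : ML) : MTL))}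

/-- Axioms (L1)–(L4) of the system `L`. -/
inductive LAxiom : MTL → Prop
  | l1 (φ ψ : MTL) : LAxiom (φ ⇛ (ψ ⇛ φ))
  | l2 (φ ψ θ : MTL) : LAxiom ((φ ⇛ (ψ ⇛ θ)) ⇛ ((φ ⇛ ψ) ⇛ (φ ⇛ θ)))
  | l3 (φ ψ : MTL) : LAxiom ((∼φ ⇛ ∼ψ) ⇛ (ψ ⇛ φ))
  | l4 (α β : ML) : LAxiom (((α.imp β : ML) : MTL) ⇛ ((α : MTL) ⇛ (β : MTL)))

/-- The system `L` of lifted propositional axioms, with modus ponens for `⇛`. -/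
def LSys : Calculus MTL where
  axs := {φ | LAxiom φ}
  rules := {r | ∃ φ ψ : MTL, r = ([φ, φ ⇛ ψ], ψ)}
  thmRules := ∅

/-- The splitting axioms: (F⊗), (F⊸), (Lax), (Ex⊸), (C⊸), (Dis⊸). -/
inductive SAxiom : MTL → Prop
  | fTensor (α β : ML) : SAxiom ((α : MTL) ⊗ (β : MTL) ⇔ (α.or β : ML))
  | fLimp (α : ML) (φ : MTL) : SAxiom ((α : MTL) ⇛ (φ ⊸ (α : MTL)))
  | lax (φ ψ θ : MTL) : SAxiom (φ ⇛ ((φ ⊸ ψ) ⇛ (θ ⊸ ψ)))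
  | ex (φ ψ θ : MTL) : SAxiom ((φ ⊸ (ψ ⊸ θ)) ⇛ (ψ ⊸ (φ ⊸ θ)))
  | contra (φ ψ : MTL) : SAxiom ((φ ⊸ ∼ψ) ⇛ (ψ ⊸ ∼φ))
  | dis (φ ψ θ : MTL) : SAxiom ((φ ⊸ (ψ ⇛ θ)) ⇛ ((φ ⊸ ψ) ⇛ (φ ⊸ θ)))

/-- The system `S`, with necessitation `φ / ψ ⊸ φ` for theorems `φ`. -/
def SSys : Calculus MTL where
  axs := {φ | SAxiom φ}
  rules := ∅
  thmRules := {r | ∃ φ ψ : MTL, r = ([φ], ψ ⊸ φ)}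

/-- The modal axioms: (Lin□), (F◇), (D◇⊗), (E□), (I□), (Dis□), (DisΔ). -/
inductive MAxiom : MTL → Prop
  | lin (φ : MTL) : MAxiom (□(∼φ) ⇔ ∼(□φ))
  | fDia (α : ML) : MAxiom (◇(α : MTL) ⇔ (α.neg.box.neg : ML))
  | dDiaTensor (φ ψ : MTL) : MAxiom (◇(φ ⊗ ψ) ⇔ (◇φ) ⊗ (◇ψ))
  | eBox (α : ML) : MAxiom (□(α : MTL) ⇛ ▵(α : MTL))
  | iBox (φ ψ : MTL) : MAxiom (◇φ ⇛ (▵ψ ⇛ □ψ))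
  | disBox (φ ψ : MTL) : MAxiom (□(φ ⇛ ψ) ⇛ (□φ ⇛ □ψ))
  | disDelta (φ ψ : MTL) : MAxiom (▵(φ ⇛ ψ) ⇛ (▵φ ⇛ ▵ψ))

/-- The system `M`, with necessitation for `□` and for `Δ` on theorems. -/
def MSys : Calculus MTL where
  axs := {φ | MAxiom φ}
  rules := ∅
  thmRules := {r | ∃ φ : MTL, r = ([φ], □φ)} ∪ {r | ∃ φ : MTL, r = ([φ], ▵φ)}

/-- The proof system `H□LSM`. -/
def HBoxLSM : Calculus MTL := ((HBox.union LSys).union SSys).union MSys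

/-! ### Semantics -/



/-- Kripke structures `(W, R, V)`. -/
structure Kripke where
  W : Type u
  R : W → W → Prop
  V : ℕ → Set W

/-- Truth of `ML` formulas in a world. -/
def Kripke.Holds (K : Kripke.{u}) : ML → K.W → Prop
  | .var p, w => w ∈ K.V p
  | .neg α, w => ¬ K.Holds α w
  | .imp α β, w => K.Holds α w → K.Holds β w
  | .box α, w => ∀ v, K.R w v → K.Holds α v

/-- The global successor `R[T]` of a team: all successors of all worlds in `T`. -/
def Kripke.image (K : Kripke.{u}) (T : Set K.W) : Set K.W := {v | ∃ w ∈ T, K.R w v}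

/-- `T'` is a successor team of `T`. -/
def Kripke.IsSuccTeam (K : Kripke.{u}) (T T' : Set K.W) : Prop :=
  (∀ w ∈ T, ∃ v ∈ T', K.R w v) ∧ (∀ v ∈ T', ∃ w ∈ T, K.R w v)

/-- Truth of `MTL` formulas in a team of worlds. That `ML` formulas are true in a team if and only
if they are true in all of its worlds is `Kripke.sat_toMTL` below. -/
def Kripke.Sat (K : Kripke.{u}) : MTL → Set K.W → Prop
  | .var p, T => ∀ w ∈ T, K.Holds (.var p) w
  | .neg α, T => ∀ w ∈ T, K.Holds (.neg α) w
  | .imp α β, T => ∀ w ∈ T, K.Holds (.imp α β) w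
  | .snot φ, T => ¬ K.Sat φ T
  | .mimp φ ψ, T => K.Sat φ T → K.Sat ψ T
  | .limp φ ψ, T => ∀ S U : Set K.W, S ∪ U = T → K.Sat φ S → K.Sat ψ U
  | .box φ, T => K.Sat φ (K.image T)
  | .delta φ, T => ∀ T' : Set K.W, K.IsSuccTeam T T' → K.Sat φ T'

/-- Team semantics is flat on `ML`. -/
theorem Kripke.sat_toMTL (K : Kripke.{u}) (α : ML) (T : Set K.W) :
    K.Sat α T ↔ ∀ w ∈ T, K.Holds α w := by
  induction α generalizing T with
  | box α ih =>
    simp only [ML.toMTL, Kripke.Sat, ih, Kripke.image, Kripke.Holds, Set.mem_ofPred_eq]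
    exact ⟨fun h w hw v hv => h v ⟨w, hw, hv⟩, fun h v ⟨w, hw, hv⟩ => h w hw v hv⟩
  | _ => simp only [ML.toMTL, Kripke.Sat]

/-- Valuations of `MTL`: a Kripke structure with a team of worlds. -/
def TeamModel : Type (u + 1) := (K : Kripke.{u}) × Set K.W

/-- The class of models of an `MTL` formula. -/
def Mod (φ : MTL) : Set TeamModel.{u} := {A | A.1.Sat φ A.2}

/-- `L ≤ L'`: every formula of `L` has a formula of `L'` with the same models. -/
def ExprLE (L L' : Set MTL) : Prop := ∀ φ ∈ L, ∃ φ' ∈ L', Mod.{u} φ = Mod.{u} φ'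

/-- `L ≡ L'`: the fragments `L` and `L'` of `MTL` are equally expressive. -/
def ExprEquiv (L L' : Set MTL) : Prop := ExprLE.{u} L L' ∧ ExprLE.{u} L' L

end TeamLogic

namespace TeamLogic

local prefix:75 "∼" => MTL.snot
local infixr:30 " ⇛ " => MTL.mimp
local infixr:40 " ⊸ " => MTL.limp
local prefix:75 "□" => MTL.box
local prefix:75 "▵" => MTL.delta
local infixl:50 " ⊗ " => MTL.tensor
local prefix:75 "◇" => MTL.dia

/-! ### Theories and valuations of a propositional language -/

/-! A world, i.e. a maximal consistent set of `MTL` formulas, plays the role of the complete theory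
of a team. The heart of the proof is `World.mem_iff_of_th_eq`: the `ML` formulas of a world decide
all its other formulas. A compactness argument (`exists_bml_iff`) then makes every formula provably
equivalent to a Boolean combination of `ML` formulas, and soundness turns provable equivalence into
equality of model classes.

The heart is a bisimulation argument by induction on the formula. On worlds, `⊸` and `Δ` are
interpreted by relations `Split` and `Succ` (`mem_limp`, `mem_delta`) and `□` by a function `image`.
Each depends on classical theories alone. The pairs of theories realised by splits of `m` are
exactly those with intersection `m.th` (`Split.th_eq`, `exists_split_of_th_eq_inter`). The theories
of successors are those containing every `α` with `□α` in `m` and consisting of formulas whose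
classical diamond is in `m` (`exists_succ_of_th`). Kripke structures enter only for soundness. -/

/-- A language with an implication and a negation. -/
class PropLang (F : Type) where
  imp : F → F → F
  neg : F → F

open PropLang

/-- Sets of formulas that contain the axioms of propositional logic and are closed under
modus ponens. -/
structure IsTheory {F : Type} [PropLang F] (T : Set F) : Prop where
  ax1 : ∀ a b : F, imp a (imp b a) ∈ T
  ax2 : ∀ a b c : F, imp (imp a (imp b c)) (imp (imp a b) (imp a c)) ∈ T
  ax3 : ∀ a b : F, imp (imp (neg a) (neg b)) (imp b a) ∈ T
  mp : ∀ {a b : F}, a ∈ T → imp a b ∈ T → b ∈ T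

/-- Sets of formulas that are the true formulas of a propositional valuation. -/
structure IsVal {F : Type} [PropLang F] (w : Set F) : Prop where
  imp_mem : ∀ a b : F, imp a b ∈ w ↔ (a ∈ w → b ∈ w)
  neg_mem : ∀ a : F, neg a ∈ w ↔ a ∉ w

section Theory

variable {F : Type} [PropLang F] {T T₁ T₂ w : Set F} {a b φ : F}

theorem IsTheory.imp_of_mem (h : IsTheory T) (a : F) (hb : b ∈ T) : imp a b ∈ T :=
  h.mp hb (h.ax1 b a)

theorem IsTheory.imp_self (h : IsTheory T) (a : F) : imp a a ∈ T :=
  h.mp (h.ax1 a a) (h.mp (h.ax1 a (imp a a)) (h.ax2 a (imp a a) a))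

/-- The deduction theorem: the consequences of `a` over a theory form a theory. -/
theorem IsTheory.under (h : IsTheory T) (a : F) : IsTheory {b | imp a b ∈ T} where
  ax1 b c := h.imp_of_mem a (h.ax1 b c)
  ax2 b c d := h.imp_of_mem a (h.ax2 b c d)
  ax3 b c := h.imp_of_mem a (h.ax3 b c)
  mp {b c} hb hbc := h.mp hb (h.mp hbc (h.ax2 a b c))

theorem IsTheory.explode (h : IsTheory T) (ha : a ∈ T) (hn : neg a ∈ T) : b ∈ T :=
  h.mp ha (h.mp (h.imp_of_mem (neg b) hn) (h.ax3 b a))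

/-- Under the assumption `neg b` both `a` and `neg a` become absurd, so `b` follows there; a formula
implied by its own negation is a member. -/
theorem IsTheory.of_imp_of_neg_imp (h : IsTheory T) (ha : imp a b ∈ T)
    (hn : imp (neg a) b ∈ T) : b ∈ T := by
  have key : b ∈ {c | imp (neg b) c ∈ T} := by
    have hN := h.under (neg b)
    have hnb : neg b ∈ {c | imp (neg b) c ∈ T} := h.imp_self _
    have contra : ∀ {c : F}, imp c b ∈ T → ∀ d, imp c d ∈ {c | imp (neg b) c ∈ T} := by
      intro c hc d
      have hc' := (hN.under c)
      exact hc'.explode (a := b) (h.imp_of_mem _ hc) (hN.imp_of_mem c hnb)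
    have h1 := contra hn (neg (imp a a))
    have h2 := hN.mp h1 (hN.ax3 a (imp a a))
    have h3 := hN.mp (hN.imp_self a) h2
    exact hN.mp h3 (contra ha b)
  have h1 : imp (neg b) (neg (imp b b)) ∈ T :=
    (h.under (neg b)).explode (a := b) key (h.imp_self _)
  exact h.mp (h.imp_self b) (h.mp h1 (h.ax3 b (imp b b)))

/-- Lindenbaum's lemma. -/
theorem IsTheory.exists_isVal (h : IsTheory T) (hφ : φ ∉ T) :
    ∃ w, IsVal w ∧ T ⊆ w ∧ φ ∉ w := by
  obtain ⟨w, hTw, hw⟩ := zorn_subset_nonempty {X : Set F | IsTheory X ∧ φ ∉ X} (by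
    intro c hc hchain hne
    obtain ⟨X, hX⟩ := hne
    refine ⟨⋃₀ c, ⟨⟨?_, ?_, ?_, ?_⟩, ?_⟩, fun s hs => Set.subset_sUnion_of_mem hs⟩
    · exact fun a b => ⟨X, hX, (hc hX).1.ax1 a b⟩
    · exact fun a b d => ⟨X, hX, (hc hX).1.ax2 a b d⟩
    · exact fun a b => ⟨X, hX, (hc hX).1.ax3 a b⟩
    · rintro a b ⟨Y, hY, ha⟩ ⟨Z, hZ, hb⟩
      rcases hchain.total hY hZ with hYZ | hZY
      · exact ⟨Z, hZ, (hc hZ).1.mp (hYZ ha) hb⟩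
      · exact ⟨Y, hY, (hc hY).1.mp ha (hZY hb)⟩
    · rintro ⟨Y, hY, hφY⟩
      exact (hc hY).2 hφY) T ⟨h, hφ⟩
  have hth := hw.prop.1
  have hnot := hw.prop.2
  -- By the deduction theorem, the consequences of `a` over `w` would otherwise be a strictly larger
  -- theory still omitting `φ`.
  have hmax : ∀ a, a ∉ w → imp a φ ∈ w := by
    intro a ha
    by_contra hcon
    have hle : w ⊆ {b | imp a b ∈ w} := fun b hb => hth.imp_of_mem a hb
    exact ha (hw.le_of_ge (y := {b | imp a b ∈ w}) ⟨hth.under a, hcon⟩ hle (hth.imp_self a))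
  have hneg : ∀ a, neg a ∈ w ↔ a ∉ w := by
    intro a
    refine ⟨fun hn ha => hnot (hth.explode ha hn), fun ha => ?_⟩
    by_contra hn
    exact hnot (hth.of_imp_of_neg_imp (hmax a ha) (hmax _ hn))
  refine ⟨w, ⟨fun a b => ⟨fun hab ha => hth.mp ha hab, fun hab => ?_⟩, hneg⟩, hTw, hnot⟩
  by_cases ha : a ∈ w
  · exact hth.imp_of_mem a (hab ha)
  · exact (hth.under a).explode (hth.imp_self a) (hth.imp_of_mem a ((hneg a).2 ha))

theorem IsTheory.mem_of_forall (h : IsTheory T) (hφ : ∀ w, IsVal w → T ⊆ w → φ ∈ w) :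
    φ ∈ T := by
  by_contra hcon
  obtain ⟨w, hw, hTw, hn⟩ := h.exists_isVal hcon
  exact hn (hφ w hw hTw)

/-- Two theories have a common valuation unless one of them refutes a member of the other. -/
theorem IsTheory.exists_isVal_of_compatible [Nonempty F] (h₁ : IsTheory T₁) (h₂ : IsTheory T₂)
    (hc : ∀ b ∈ T₂, neg b ∉ T₁) : ∃ w, IsVal w ∧ T₁ ⊆ w ∧ T₂ ⊆ w := by
  -- The theory generated by `T₁ ∪ T₂`. One premise from `T₂` suffices, as `T₂` is closed under the
  -- conjunction `neg (imp b (neg c))`.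
  set J : Set F := {θ | ∃ b ∈ T₂, imp b θ ∈ T₁} with hJ
  have sub₂ : T₂ ⊆ J := fun θ hθ => ⟨θ, hθ, h₁.imp_self θ⟩
  obtain ⟨a₀⟩ := ‹Nonempty F›
  obtain ⟨b₀, hb₀⟩ : ∃ b, b ∈ T₂ := ⟨_, h₂.imp_self a₀⟩
  have sub₁ : T₁ ⊆ J := fun θ hθ => ⟨b₀, hb₀, h₁.imp_of_mem _ hθ⟩
  have hth : IsTheory J := by
    refine ⟨fun a b => sub₂ (h₂.ax1 a b), fun a b c => sub₂ (h₂.ax2 a b c),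
      fun a b => sub₂ (h₂.ax3 a b), ?_⟩
    rintro x y ⟨b, hb, hbx⟩ ⟨c, hc, hcy⟩
    refine ⟨neg (imp b (neg c)), h₂.mem_of_forall ?_, h₁.mem_of_forall ?_⟩
    · intro w hw hTw
      have := hTw hb
      have := hTw hc
      simp only [hw.neg_mem, hw.imp_mem]; tauto
    · intro w hw hTw
      have h1 := hTw hbx
      have h2 := hTw hcy
      simp only [hw.neg_mem, hw.imp_mem] at *; tauto
  obtain ⟨w, hw, hJw, -⟩ := hth.exists_isVal (φ := neg (imp b₀ b₀)) (by
    rintro ⟨b, hb, hbn⟩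
    refine hc b hb (h₁.mem_of_forall fun w hw hTw => ?_)
    have h1 := hTw hbn
    simp only [hw.neg_mem, hw.imp_mem] at *; tauto)
  exact ⟨w, hw, sub₁.trans hJw, sub₂.trans hJw⟩

end Theory

instance : PropLang ML := ⟨ML.imp, ML.neg⟩

instance : PropLang MTL := ⟨MTL.mimp, MTL.snot⟩

instance : Nonempty MTL := ⟨.var 0⟩

/-! ### Theorems of the calculus -/

/-- The theorems of `H□LSM`. -/
def Thm : Set MTL := {φ | HBoxLSM.Derives ∅ φ}

theorem Thm.hBox {φ : MTL} (h : HBoxAxiom φ) : φ ∈ Thm := .ax (.inl (.inl (.inl h)))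

theorem Thm.l {φ : MTL} (h : LAxiom φ) : φ ∈ Thm := .ax (.inl (.inl (.inr h)))

theorem Thm.s {φ : MTL} (h : SAxiom φ) : φ ∈ Thm := .ax (.inl (.inr h))

theorem Thm.m {φ : MTL} (h : MAxiom φ) : φ ∈ Thm := .ax (.inr h)

theorem derives_mp {Φ : Set MTL} {φ ψ : MTL} (h : HBoxLSM.Derives Φ φ)
    (h' : HBoxLSM.Derives Φ (φ ⇛ ψ)) : HBoxLSM.Derives Φ ψ :=
  .rule (ξs := [φ, φ ⇛ ψ]) (.inl (.inl (.inr ⟨φ, ψ, rfl⟩))) (by simp [h, h'])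

theorem Thm.limp {φ : MTL} (ψ : MTL) (h : φ ∈ Thm) : (ψ ⊸ φ) ∈ Thm :=
  .thmRule (ξs := [φ]) (.inl (.inr ⟨φ, ψ, rfl⟩)) (List.forall_mem_singleton.2 h)

theorem Thm.box {φ : MTL} (h : φ ∈ Thm) : □φ ∈ Thm :=
  .thmRule (ξs := [φ]) (.inr (.inl ⟨φ, rfl⟩)) (List.forall_mem_singleton.2 h)

theorem Thm.delta {φ : MTL} (h : φ ∈ Thm) : ▵φ ∈ Thm :=
  .thmRule (ξs := [φ]) (.inr (.inr ⟨φ, rfl⟩)) (List.forall_mem_singleton.2 h)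

theorem derives_mono {Φ Ψ : Set MTL} {φ : MTL} (h : HBoxLSM.Derives Φ φ) (hs : Φ ⊆ Ψ) :
    HBoxLSM.Derives Ψ φ := by
  induction h with
  | prem h => exact .prem (hs h)
  | ax h => exact .ax h
  | rule h _ ih => exact .rule h fun ξ hξ => ih ξ hξ hs
  | thmRule h h' _ => exact .thmRule h h'

theorem isTheory_thm : IsTheory Thm where
  ax1 φ ψ := Thm.l (.l1 φ ψ)
  ax2 φ ψ θ := Thm.l (.l2 φ ψ θ)
  ax3 φ ψ := Thm.l (.l3 φ ψ)
  mp h h' := derives_mp h h'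

/-! ### Canonical worlds -/

/-- Maximal consistent sets of formulas. -/
structure World where
  carrier : Set MTL
  isVal : IsVal carrier
  thm_subset : Thm ⊆ carrier

namespace World

instance : Membership MTL World := ⟨fun m φ => φ ∈ m.carrier⟩

@[simp] theorem mem_mimp {m : World} {φ ψ : MTL} : (φ ⇛ ψ) ∈ m ↔ (φ ∈ m → ψ ∈ m) :=
  m.isVal.imp_mem φ ψ

@[simp] theorem mem_snot {m : World} {φ : MTL} : ∼φ ∈ m ↔ φ ∉ m := m.isVal.neg_mem φ

@[simp] theorem mem_and {m : World} {φ ψ : MTL} : φ.and ψ ∈ m ↔ φ ∈ m ∧ ψ ∈ m := by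
  simp [MTL.and]

@[simp] theorem mem_iff {m : World} {φ ψ : MTL} : φ.iff ψ ∈ m ↔ (φ ∈ m ↔ ψ ∈ m) := by
  simp only [MTL.iff, mem_and, mem_mimp]; tauto

theorem mem_of_thm (m : World) {φ : MTL} (h : φ ∈ Thm) : φ ∈ m := m.thm_subset h

end World

/-- Lindenbaum's lemma for the calculus. Propositional derivations inside the calculus can thereby
be replaced by truth-table reasoning in an arbitrary world. -/
theorem mem_thm_iff {φ : MTL} : φ ∈ Thm ↔ ∀ m : World, φ ∈ m :=
  ⟨fun h m => m.mem_of_thm h, fun h => isTheory_thm.mem_of_forall fun w hw hT => h ⟨w, hw, hT⟩⟩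

/-- Sets of formulas that contain the theorems of `H□LSM` and are closed under modus ponens. -/
structure IsTeamTheory (X : Set MTL) : Prop where
  of_valid : ∀ θ : MTL, (∀ m : World, θ ∈ m) → θ ∈ X
  mp : ∀ φ ψ : MTL, φ ∈ X → (φ ⇛ ψ) ∈ X → ψ ∈ X

namespace IsTeamTheory

theorem isTheory {X : Set MTL} (h : IsTeamTheory X) : IsTheory X where
  ax1 φ ψ := h.of_valid _ (mem_thm_iff.1 (isTheory_thm.ax1 φ ψ))
  ax2 φ ψ θ := h.of_valid _ (mem_thm_iff.1 (isTheory_thm.ax2 φ ψ θ))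
  ax3 φ ψ := h.of_valid _ (mem_thm_iff.1 (isTheory_thm.ax3 φ ψ))
  mp h1 h2 := h.mp _ _ h1 h2

theorem exists_world {X Y : Set MTL} (hX : IsTeamTheory X) (hY : IsTeamTheory Y)
    (h : ∀ ψ ∈ Y, ∼ψ ∉ X) : ∃ m : World, (∀ φ ∈ X, φ ∈ m) ∧ ∀ φ ∈ Y, φ ∈ m := by
  obtain ⟨w, hw, h1, h2⟩ := hX.isTheory.exists_isVal_of_compatible hY.isTheory h
  exact ⟨⟨w, hw, fun φ hφ => h1 (hX.of_valid φ (mem_thm_iff.1 hφ))⟩, fun φ => @h1 φ,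
    fun φ => @h2 φ⟩

theorem world (m : World) : IsTeamTheory {φ | φ ∈ m} :=
  ⟨fun _ h => h m, fun _ _ h h' => World.mem_mimp.1 h' h⟩

theorem consequences (φ : MTL) : IsTeamTheory {θ | ∀ m : World, φ ∈ m → θ ∈ m} :=
  ⟨fun _ h m _ => h m, fun _ _ h h' m hm => World.mem_mimp.1 (h' m hm) (h m hm)⟩

end IsTeamTheory

/-! ### The classical theory of a world -/

/-- The `ML` formulas of a world. -/
def World.th (m : World) : Set ML := {α | (α : MTL) ∈ m}

theorem World.mem_th {m : World} {α : ML} : α ∈ m.th ↔ (α : MTL) ∈ m := Iff.rfl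

theorem World.isTheory_th (m : World) : IsTheory m.th where
  ax1 α β := m.mem_of_thm (.hBox (.a1 α β))
  ax2 α β γ := m.mem_of_thm (.hBox (.a2 α β γ))
  ax3 α β := m.mem_of_thm (.hBox (.a3 α β))
  mp {α β} h h' := World.mem_mimp.1 (World.mem_mimp.1 (m.mem_of_thm (.l (.l4 α β))) h') h

@[simp] theorem IsVal.ml_imp {w : Set ML} (h : IsVal w) (α β : ML) :
    α.imp β ∈ w ↔ (α ∈ w → β ∈ w) := h.imp_mem α β

@[simp] theorem IsVal.ml_neg {w : Set ML} (h : IsVal w) (α : ML) :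
    α.neg ∈ w ↔ α ∉ w := h.neg_mem α

/-- A falsity of `ML`. -/
def ML.bot : ML := ((ML.var 0).imp (ML.var 0)).neg

@[simp] theorem IsVal.ml_bot {w : Set ML} (h : IsVal w) : ML.bot ∉ w := by
  simp [ML.bot, h]

/-- The conjunction of `ML`. -/
def ML.and (α β : ML) : ML := (α.imp β.neg).neg

@[simp] theorem IsVal.ml_and {w : Set ML} (h : IsVal w) (α β : ML) :
    α.and β ∈ w ↔ α ∈ w ∧ β ∈ w := by
  simp [ML.and, h]

@[simp] theorem IsVal.ml_or {w : Set ML} (h : IsVal w) (α β : ML) :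
    α.or β ∈ w ↔ α ∈ w ∨ β ∈ w := by
  simp only [ML.or, h.ml_imp, h.ml_neg]; tauto

/-! ### The canonical relation of `⊸` -/

/-- `m.Split a b`: the team of `m` may be split into those of `a` and `b`. -/
def World.Split (m a b : World) : Prop := ∀ φ ψ : MTL, (φ ⊸ ψ) ∈ m → φ ∈ a → ψ ∈ b

namespace World

variable {m a b c d : World}

theorem limp_mono_right {φ ψ ψ' : MTL} (h : ∀ n : World, ψ ∈ n → ψ' ∈ n)
    (hm : (φ ⊸ ψ) ∈ m) : (φ ⊸ ψ') ∈ m := by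
  have h1 : (ψ ⇛ ψ') ∈ Thm := mem_thm_iff.2 (by simpa using h)
  have h2 := m.mem_of_thm (Thm.limp φ h1)
  have h3 := m.mem_of_thm (.s (.dis φ ψ ψ'))
  simp only [mem_mimp] at h3
  exact h3 h2 hm

theorem limp_snot_comm {φ ψ : MTL} (hm : (φ ⊸ ∼ψ) ∈ m) : (ψ ⊸ ∼φ) ∈ m :=
  mem_mimp.1 (m.mem_of_thm (.s (.contra φ ψ))) hm

/-- Contraposing swaps the two sides of `⊸`, so monotonicity on the right, applied between two
contrapositions, gives antitonicity on the left. -/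
theorem limp_mono_left {φ φ' ψ : MTL} (h : ∀ n : World, φ' ∈ n → φ ∈ n)
    (hm : (φ ⊸ ψ) ∈ m) : (φ' ⊸ ψ) ∈ m := by
  have h1 : (φ ⊸ ∼∼ψ) ∈ m := limp_mono_right (by simp) hm
  have h2 : (∼ψ ⊸ ∼φ') ∈ m :=
    limp_mono_right (fun n => by simpa using mt (h n)) (limp_snot_comm h1)
  exact limp_mono_right (by simp) (limp_snot_comm h2)

theorem Split.symm (h : m.Split a b) : m.Split b a := by
  intro φ ψ hm hφ
  by_contra hψ
  have h1 : (φ ⊸ ∼∼ψ) ∈ m := limp_mono_right (by simp) hm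
  exact mem_snot.1 (h _ _ (limp_snot_comm h1) (mem_snot.2 hψ)) hφ

/-- The axiom (Lax) says that a part may be enlarged to the whole team: `S ∪ U = T` implies `T ∪ U =
T`. -/
theorem Split.self_left (h : m.Split a b) : m.Split m b := by
  intro φ ψ hm hφ
  have h1 := m.mem_of_thm (.s (.lax φ ψ (φ ⇛ φ)))
  simp only [mem_mimp] at h1
  exact h _ _ (h1 hφ hm) (by simp)

theorem limp_dis {φ ψ ψ' : MTL} (h1 : (φ ⊸ ψ) ∈ m) (h2 : (φ ⊸ (ψ ⇛ ψ')) ∈ m) :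
    (φ ⊸ ψ') ∈ m := by
  have h3 := m.mem_of_thm (.s (.dis φ ψ ψ'))
  simp only [mem_mimp] at h3
  exact h3 h2 h1

theorem limp_of_valid {ψ : MTL} (φ : MTL) (h : ∀ n : World, ψ ∈ n) : (φ ⊸ ψ) ∈ m :=
  m.mem_of_thm (Thm.limp φ (mem_thm_iff.2 h))

/-- What the right part of a split has to satisfy if the left part satisfies `X`. -/
theorem isTeamTheory_residual (m : World) {X : Set MTL} (hX : IsTeamTheory X) :
    IsTeamTheory {ψ | ∃ φ ∈ X, (φ ⊸ ψ) ∈ m} := by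
  refine ⟨fun θ h => ⟨θ, hX.of_valid θ h, limp_of_valid _ h⟩, ?_⟩
  rintro ψ ψ' ⟨φ, hφ, h1⟩ ⟨φ', hφ', h2⟩
  refine ⟨φ.and φ', ?_, limp_dis (limp_mono_left (by simp +contextual) h1)
    (limp_mono_left (by simp +contextual) h2)⟩
  have h3 : (φ ⇛ φ' ⇛ φ.and φ') ∈ X := hX.of_valid _ (by simp +contextual)
  exact hX.mp _ _ hφ' (hX.mp _ _ hφ h3)

/-- The right part is completed first, against the residual of `X`; the left part is then chosen
against the residual of that finished world, which (C⊸) makes compatible with `X`. -/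
theorem exists_split {X Y : Set MTL} (hX : IsTeamTheory X) (hY : IsTeamTheory Y)
    (h : ∀ φ ∈ X, ∀ ψ ∈ Y, (φ ⊸ ∼ψ) ∉ m) :
    ∃ a b : World, m.Split a b ∧ (∀ φ ∈ X, φ ∈ a) ∧ ∀ ψ ∈ Y, ψ ∈ b := by
  obtain ⟨b, hb, hYb⟩ := (m.isTeamTheory_residual hX).exists_world hY (by
    rintro ψ hψ ⟨φ, hφ, hm⟩
    exact h φ hφ ψ hψ hm)
  obtain ⟨a, ha, hXa⟩ := (m.isTeamTheory_residual (.world b)).exists_world hX (by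
    rintro φ hφ ⟨ψ, hψ, hm⟩
    exact mem_snot.1 (hb _ ⟨φ, hφ, limp_snot_comm hm⟩) hψ)
  refine ⟨a, b, Split.symm fun φ ψ hm hφ => ha ψ ⟨φ, hφ, hm⟩, hXa, hYb⟩

theorem mem_limp {φ ψ : MTL} :
    (φ ⊸ ψ) ∈ m ↔ ∀ a b : World, m.Split a b → φ ∈ a → ψ ∈ b := by
  refine ⟨fun hm a b h => h φ ψ hm, fun h => ?_⟩
  by_contra hm
  obtain ⟨a, b, hab, ha, hb⟩ := exists_split (m := m) (.consequences φ) (.consequences (∼ψ)) (by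
    intro φ' hφ' ψ' hψ' hm'
    refine hm (limp_mono_right (fun n hn => ?_) (limp_mono_left hφ' hm'))
    by_contra hc
    exact mem_snot.1 hn (hψ' n (mem_snot.2 hc)))
  exact mem_snot.1 (hb _ fun _ h => h) (h a b hab (ha _ fun _ h => h))

theorem mem_tensor {φ ψ : MTL} :
    φ ⊗ ψ ∈ m ↔ ∃ a b : World, m.Split a b ∧ φ ∈ a ∧ ψ ∈ b := by
  simp [MTL.tensor, mem_limp]

/-- Reflects `a ∪ (c ∪ d) = c ∪ (a ∪ d)`, via the axiom (Ex⊸). -/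
theorem Split.exchange (h : m.Split a b) (h' : b.Split c d) :
    ∃ e : World, m.Split c e ∧ e.Split a d := by
  -- These are the formulas forced on `e` by `e.Split a d`: the consequences of all `∼(φ ⊸ ψ)` with
  -- `φ` in `a` and `ψ` not in `d`. Two of them merge by conjoining the `φ`s and disjoining the
  -- `ψ`s.
  have hY : IsTeamTheory {θ | ∃ φ ∈ a, ∃ ψ, ψ ∉ d ∧ ∀ n : World, (φ ⊸ ψ) ∉ n → θ ∈ n} := by
    refine ⟨fun θ h => ⟨θ ⇛ θ, by simp, ∼(θ ⇛ θ), by simp, fun n _ => h n⟩, ?_⟩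
    rintro θ θ' ⟨φ, hφ, ψ, hψ, h1⟩ ⟨φ', hφ', ψ', hψ', h2⟩
    refine ⟨φ.and φ', by simp [hφ, hφ'], ∼ψ ⇛ ψ', by simp [hψ, hψ'], fun n hn => ?_⟩
    refine mem_mimp.1 (h2 n fun hc => hn ?_) (h1 n fun hc => hn ?_)
    · exact limp_mono_right (by simp +contextual) (limp_mono_left (by simp +contextual) hc)
    · exact limp_mono_right (fun k hk => by simp [hk]) (limp_mono_left (by simp +contextual) hc)
  obtain ⟨e, he, hYe⟩ := (m.isTeamTheory_residual (.world c)).exists_world hY (by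
    rintro θ ⟨φ, hφ, ψ, hψ, hθ⟩ ⟨χ, hχ, hm⟩
    have h1 : (χ ⊸ (φ ⊸ ψ)) ∈ m := limp_mono_right (fun n hn => by
      by_contra hc
      exact mem_snot.1 hn (hθ n hc)) hm
    exact hψ (h' _ _ (h _ _ (mem_mimp.1 (m.mem_of_thm (.s (.ex χ φ ψ))) h1) hφ) hχ))
  refine ⟨e, fun φ ψ hm hφ => he ψ ⟨φ, hφ, hm⟩, fun φ ψ hm hφ => ?_⟩
  by_contra hψ
  have := hYe (∼(φ ⊸ ψ)) ⟨φ, hφ, ψ, hψ, fun n hn => mem_snot.2 hn⟩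
  exact mem_snot.1 this hm

theorem Split.th_subset_right (h : m.Split a b) : m.th ⊆ b.th := fun α hα =>
  h (α ⇛ α) α (mem_mimp.1 (m.mem_of_thm (.s (.fLimp α _))) hα) (by simp)

theorem Split.th_subset_left (h : m.Split a b) : m.th ⊆ a.th := h.symm.th_subset_right

theorem or_mem_th_iff {α β : ML} :
    α.or β ∈ m.th ↔ ∃ a b : World, m.Split a b ∧ α ∈ a.th ∧ β ∈ b.th :=
  (mem_iff.1 (m.mem_of_thm (.s (.fTensor α β)))).symm.trans mem_tensor

/-- Union closure of classical formulas: (F⊗) puts `α ∨ α` in `m`. -/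
theorem Split.mem_th (h : m.Split a b) {α : ML} (ha : α ∈ a.th) (hb : α ∈ b.th) : α ∈ m.th :=
  m.isTheory_th.mem_of_forall fun w hw hs => by
    simpa [hw] using hs (or_mem_th_iff.2 ⟨a, b, h, ha, hb⟩)

theorem Split.th_eq (h : m.Split a b) : m.th = a.th ∩ b.th :=
  Set.Subset.antisymm (fun _ hα => ⟨h.th_subset_left hα, h.th_subset_right hα⟩)
    fun _ hα => h.mem_th hα.1 hα.2

/-- A world can be split according to the truth of an `ML` formula. -/
theorem exists_split_ml (m : World) (α : ML) :
    ∃ a b : World, m.Split a b ∧ α ∈ a.th ∧ α.neg ∈ b.th :=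
  or_mem_th_iff.1 (m.isTheory_th.mem_of_forall fun w hw _ => by simp [hw, em])

theorem Split.imp_mem_th {α β : ML} (h : m.Split a b) (ha : β ∈ a.th) (hb : α.neg ∈ b.th) :
    α.imp β ∈ m.th :=
  h.mem_th (a.isTheory_th.imp_of_mem α ha) (b.isTheory_th.mem_of_forall fun w hw hs => by
    have := hs hb
    simp only [hw.ml_neg, hw.ml_imp] at *; tauto)

end World

/-! ### Descriptions of classical theories -/

/-- `α` and the strong negations of the formulas of `l`. -/
def descr (α : ML) : List ML → MTL
  | [] => α
  | β :: l => (descr α l).and (∼(β : MTL))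

theorem World.mem_descr {m : World} {α : ML} {l : List ML} :
    descr α l ∈ m ↔ α ∈ m.th ∧ ∀ β ∈ l, β ∉ m.th := by
  induction l with
  | nil => simp [descr, World.mem_th]
  | cons β l ih => simp [descr, ih, World.mem_th]; tauto

/-- The consequences of having the classical theory `t`. -/
def diagram (t : Set ML) : Set MTL :=
  {φ | ∃ α ∈ t, ∃ l : List ML, (∀ β ∈ l, β ∉ t) ∧ ∀ n : World, descr α l ∈ n → φ ∈ n}

/-- Positive information merges into one conjunction, but `t` need not be prime: its complement may
fail to be closed under disjunction, so the refuted formulas are kept as a list. -/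
theorem isTeamTheory_diagram {t : Set ML} (ht : IsTheory t) : IsTeamTheory (diagram t) := by
  refine ⟨fun θ h => ⟨_, ht.ax1 (.var 0) (.var 0), [], by simp, fun n _ => h n⟩, ?_⟩
  rintro φ ψ ⟨α, hα, l, hl, h⟩ ⟨α', hα', l', hl', h'⟩
  refine ⟨α.and α', ht.mem_of_forall fun w hw hs => ?_, l ++ l', ?_, fun n hn => ?_⟩
  · simp [hw, hs hα, hs hα']
  · intro β hβ
    rcases List.mem_append.1 hβ with hβ | hβ
    exacts [hl β hβ, hl' β hβ]
  · rw [World.mem_descr] at hn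
    refine World.mem_mimp.1 (h' n (World.mem_descr.2 ⟨?_, fun β hβ => hn.2 β (by simp [hβ])⟩))
      (h n (World.mem_descr.2 ⟨?_, fun β hβ => hn.2 β (by simp [hβ])⟩))
    all_goals
      refine n.isTheory_th.mem_of_forall fun w hw hs => ?_
      have := hs hn.1
      simp_all

theorem World.th_eq_of_diagram {t : Set ML} (ht : IsTheory t) {m : World}
    (h : ∀ φ ∈ diagram t, φ ∈ m) : m.th = t := by
  ext α
  refine ⟨fun hα => ?_, fun hα => h _ ⟨α, hα, [], by simp, fun n hn => hn⟩⟩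
  by_contra hc
  refine World.mem_snot.1 (h (∼(α : MTL)) ⟨_, ht.ax1 α α, [α], by simpa using hc, ?_⟩) hα
  intro n hn
  exact World.mem_snot.2 ((World.mem_descr.1 hn).2 α (by simp))

namespace World

/-- Every decomposition of the classical theory of a world comes from a split. -/
theorem exists_split_of_th_eq_inter {m : World} {t₁ t₂ : Set ML} (h₁ : IsTheory t₁)
    (h₂ : IsTheory t₂) (h : m.th = t₁ ∩ t₂) :
    ∃ a b : World, m.Split a b ∧ a.th = t₁ ∧ b.th = t₂ := by
  obtain ⟨a, b, hab, ha, hb⟩ := exists_split (m := m) (isTeamTheory_diagram h₁)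
    (isTeamTheory_diagram h₂) (by
    rintro φ ⟨α, hα, l, hl, hφ⟩ ψ ⟨γ, hγ, k, hk, hψ⟩ hm
    -- The left part `p` consists of all points satisfying `α`. Were some `β` of `l` true in it, `α
    -- → β` would lie in `m.th`, hence in `t₁`.
    obtain ⟨p, q, hpq, hp, hq⟩ := m.exists_split_ml α
    have hor : α.or γ ∈ m.th := by
      rw [h]
      exact ⟨h₁.mem_of_forall fun w hw hs => by simp [hw, hs hα],
        h₂.mem_of_forall fun w hw hs => by simp [hw, hs hγ]⟩
    have hqγ : γ ∈ q.th := q.isTheory_th.mem_of_forall fun w hw hs => by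
      have h1 := hs hq
      have h2 := hs (hpq.th_subset_right hor)
      simp only [hw.ml_neg, hw.ml_or] at h1 h2
      tauto
    have hpφ : φ ∈ p := hφ p (mem_descr.2 ⟨hp, fun β hβ hc => hl β hβ (h₁.mp hα
      (h ▸ hpq.imp_mem_th hc hq : α.imp β ∈ t₁ ∩ t₂).1)⟩)
    -- The right part `e` collects all points satisfying `γ`: those of `q`, where `γ` holds
    -- throughout, and those of `p` satisfying `γ`, i.e. `p₁`. The two parts may overlap.
    obtain ⟨p₁, p₂, hsp, hp₁, hp₂⟩ := p.exists_split_ml γ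
    obtain ⟨e, hme, hse⟩ := hpq.symm.exchange hsp.symm.self_left
    refine mem_snot.1 (hme φ (∼ψ) hm hpφ) (hψ e (mem_descr.2 ⟨hse.mem_th hqγ hp₁, ?_⟩))
    intro δ hδ hc
    have hpδ := hsp.imp_mem_th (hse.th_subset_right hc) hp₂
    have hqδ := q.isTheory_th.imp_of_mem γ (hse.th_subset_left hc)
    exact hk δ hδ (h₂.mp hγ (h ▸ hpq.mem_th hpδ hqδ : γ.imp δ ∈ t₁ ∩ t₂).2))
  exact ⟨a, b, hab, th_eq_of_diagram h₁ ha, th_eq_of_diagram h₂ hb⟩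

/-! ### The canonical relations of `□` and `Δ` -/

variable {m : World}

/-- The world of the formulas `φ` with `□φ` in `m`. -/
def image (m : World) : World where
  carrier := {φ | □φ ∈ m}
  isVal := by
    have hneg : ∀ φ : MTL, □(∼φ) ∈ m ↔ □φ ∉ m := fun φ => by
      have h := m.mem_of_thm (.m (.lin φ))
      rwa [mem_iff, mem_snot] at h
    have hmp : ∀ φ ψ : MTL, □(φ ⇛ ψ) ∈ m → □φ ∈ m → □ψ ∈ m := fun φ ψ => by
      have h := m.mem_of_thm (.m (.disBox φ ψ))
      rwa [mem_mimp, mem_mimp] at h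
    have hval : ∀ φ : MTL, (∀ n : World, φ ∈ n) → □φ ∈ m := fun φ h =>
      m.mem_of_thm (Thm.box (mem_thm_iff.2 h))
    refine ⟨fun φ ψ => ⟨hmp φ ψ, fun h => ?_⟩, hneg⟩
    by_cases hφ : □φ ∈ m
    · exact hmp _ _ (hval (ψ ⇛ φ ⇛ ψ) (by simp +contextual)) (h hφ)
    · exact hmp _ _ (hval (∼φ ⇛ φ ⇛ ψ) (by simp +contextual)) ((hneg φ).2 hφ)
  thm_subset _ h := m.mem_of_thm (Thm.box h)

theorem mem_image {φ : MTL} : φ ∈ m.image ↔ □φ ∈ m := Iff.rfl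

theorem th_image : m.image.th = {α | α.box ∈ m.th} := rfl

/-- `m.Succ n`: the team of `n` may be a successor team of the team of `m`. -/
def Succ (m n : World) : Prop := ∀ φ : MTL, ▵φ ∈ m → φ ∈ n

theorem isTeamTheory_delta (m : World) : IsTeamTheory {φ | ▵φ ∈ m} := by
  refine ⟨fun φ h => m.mem_of_thm (Thm.delta (mem_thm_iff.2 h)), fun φ ψ hφ h => ?_⟩
  have h1 := m.mem_of_thm (.m (.disDelta φ ψ))
  rw [mem_mimp, mem_mimp] at h1
  exact h1 h hφ

theorem exists_succ {X : Set MTL} (hX : IsTeamTheory X) (h : ∀ φ ∈ X, ◇φ ∈ m) :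
    ∃ n : World, m.Succ n ∧ ∀ φ ∈ X, φ ∈ n :=
  m.isTeamTheory_delta.exists_world hX fun φ hφ => mem_snot.1 (h φ hφ)

theorem mem_delta {φ : MTL} : ▵φ ∈ m ↔ ∀ n : World, m.Succ n → φ ∈ n := by
  refine ⟨fun hm n h => h φ hm, fun h => ?_⟩
  by_contra hm
  obtain ⟨n, hn, hφ⟩ := m.isTeamTheory_delta.exists_world (.consequences (∼φ)) (by
    intro ψ hψ hc
    refine hm (m.isTeamTheory_delta.mp _ _ hc (m.isTeamTheory_delta.of_valid _ fun n => ?_))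
    rw [mem_mimp, mem_snot]
    intro hn
    by_contra hφ
    exact hn (hψ n (mem_snot.2 hφ)))
  exact mem_snot.1 (hφ _ fun _ h => h) (h n hn)

theorem mem_dia {φ : MTL} : ◇φ ∈ m ↔ ∃ n : World, m.Succ n ∧ φ ∈ n := by
  simp [MTL.dia, mem_delta]

theorem mem_dia_ml {α : ML} : ◇(α : MTL) ∈ m ↔ α.neg.box.neg ∈ m.th :=
  mem_iff.1 (m.mem_of_thm (.m (.fDia α)))

/-- With `Succ.neg_box_neg_mem_th`, this shows that the hypotheses of `exists_succ_of_th` are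
necessary. -/
theorem Succ.mem_th {n : World} (h : m.Succ n) {α : ML} (hα : α.box ∈ m.th) : α ∈ n.th :=
  h _ (mem_mimp.1 (m.mem_of_thm (.m (.eBox α))) hα)

theorem Succ.neg_box_neg_mem_th {n : World} (h : m.Succ n) {α : ML} (hα : α ∈ n.th) :
    α.neg.box.neg ∈ m.th :=
  mem_dia_ml.1 (mem_dia.2 ⟨n, h, hα⟩)

/-- The empty team has no nonempty successor teams. -/
theorem Succ.bot_mem_th {n : World} (h : m.Succ n) (hn : ML.bot ∈ n.th) : ML.bot ∈ m.th := by
  have hnec : ML.bot.neg.box ∈ m.th := by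
    have h1 : (ML.bot.neg : MTL) ∈ Thm := mem_thm_iff.2 fun k =>
      k.isTheory_th.mem_of_forall fun w hw _ => by simp [hw]
    exact m.mem_of_thm (Thm.box h1)
  exact m.isTheory_th.explode hnec (h.neg_box_neg_mem_th hn)

/-- A condition on the classical theories of two worlds under which the second one may be
replaced by a successor of the first one. -/
theorem exists_succ_of_th {m : World} {t : Set ML} (ht : IsTheory t)
    (h₁ : ∀ α : ML, α.box ∈ m.th → α ∈ t) (h₂ : ∀ α ∈ t, α.neg.box.neg ∈ m.th) :
    ∃ n : World, m.Succ n ∧ n.th = t := by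
  have key : ∀ α ∈ t, ∀ l : List ML, (∀ β ∈ l, β ∉ t) → ◇(descr α l) ∈ m := by
    intro α hα l hl
    induction l with
    | nil => exact mem_dia_ml.2 (h₂ α hα)
    | cons β l ih =>
      -- A successor refuting all of `l` is joined with one refuting `β`. The latter is a successor
      -- of the part `p` of points seeing `α ∧ ¬β`, which is nonempty because `β ∉ t`. The axiom
      -- (D◇⊗) glues the two, and `α` survives the union.
      have hl' := ih fun γ hγ => hl γ (by simp [hγ])
      set γ : ML := (α.imp β).neg with hγ
      obtain ⟨q, p, hqp, hq, hp⟩ := m.exists_split_ml γ.neg.box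
      have hbox : γ.neg.box ∉ m.th := fun hc => hl β (by simp) (ht.mp hα
        (ht.mem_of_forall fun w hw hs => by simpa [hγ, hw] using hs (h₁ _ hc) : α.imp β ∈ t))
      have hpb : ML.bot ∉ p.th := fun hc => hbox (hqp.mem_th hq
        (p.isTheory_th.mem_of_forall fun w hw hs => absurd (hs hc) hw.ml_bot))
      obtain ⟨n, hpn, hn⟩ := mem_dia.1 (mem_dia_ml.2 hp)
      have hnα : descr α [β] ∈ n := by
        rw [mem_descr]
        refine ⟨n.isTheory_th.mem_of_forall fun w hw hs => ?_, ?_⟩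
        · have := hs hn
          simp only [hγ, hw.ml_neg, hw.ml_imp] at this
          tauto
        · intro δ hδ hc
          obtain rfl : δ = β := by simpa using hδ
          refine hpb (hpn.bot_mem_th (n.isTheory_th.mem_of_forall fun w hw hs => ?_))
          have h1 := hs hn
          have h2 := hs hc
          simp only [hγ, hw.ml_neg, hw.ml_imp] at h1
          tauto
      have hdia : ◇(descr α l ⊗ descr α [β]) ∈ m :=
        (mem_iff.1 (m.mem_of_thm (.m (.dDiaTensor _ _)))).2
          (mem_tensor.2 ⟨m, p, hqp.self_left, hl', mem_dia.2 ⟨n, hpn, hnα⟩⟩)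
      obtain ⟨k, hmk, hk⟩ := mem_dia.1 hdia
      obtain ⟨k₁, k₂, hs, hk₁, hk₂⟩ := mem_tensor.1 hk
      rw [mem_descr] at hk₁ hk₂
      refine mem_dia.2 ⟨k, hmk, mem_descr.2 ⟨hs.mem_th hk₁.1 hk₂.1, fun δ hδ hc => ?_⟩⟩
      rcases List.mem_cons.1 hδ with rfl | hδ
      · exact hk₂.2 δ (by simp) (hs.th_subset_right hc)
      · exact hk₁.2 δ hδ (hs.th_subset_left hc)
  obtain ⟨n, hmn, hn⟩ := exists_succ (m := m) (isTeamTheory_diagram ht) (by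
    rintro φ ⟨α, hα, l, hl, hφ⟩
    obtain ⟨n, hmn, hn⟩ := mem_dia.1 (key α hα l hl)
    exact mem_dia.2 ⟨n, hmn, hφ n hn⟩)
  exact ⟨n, hmn, th_eq_of_diagram ht hn⟩

/-- The formulas of a world are determined by its classical formulas. -/
theorem mem_iff_of_th_eq (φ : MTL) : ∀ m m' : World, m.th = m'.th → (φ ∈ m ↔ φ ∈ m') := by
  refine MTL.closure_induction (P := fun φ => ∀ m m' : World, m.th = m'.th → (φ ∈ m ↔ φ ∈ m'))
    ?_ ?_ ?_ ?_ ?_ ?_ φ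
  · exact fun α m m' h => Set.ext_iff.1 h α
  · exact fun φ ih m m' h => by rw [mem_snot, mem_snot, ih m m' h]
  · exact fun φ ψ ih ih' m m' h => by rw [mem_mimp, mem_mimp, ih m m' h, ih' m m' h]
  · intro φ ψ ih ih'
    have aux : ∀ m m' : World, m.th = m'.th → (φ ⊸ ψ) ∈ m → (φ ⊸ ψ) ∈ m' := by
      intro m m' h hm
      refine mem_limp.2 fun a' b' hs ha' => ?_
      -- The back condition of a bisimulation: a split of `m'` is matched by one of `m` with the
      -- same classical theories.
      obtain ⟨a, b, hs', ha, hb⟩ :=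
        exists_split_of_th_eq_inter a'.isTheory_th b'.isTheory_th (h.trans hs.th_eq)
      exact (ih' b b' hb).1 (hs' φ ψ hm ((ih a a' ha).2 ha'))
    exact fun m m' h => ⟨aux m m' h, aux m' m h.symm⟩
  · intro φ ih m m' h
    rw [← mem_image, ← mem_image]
    exact ih _ _ (by rw [th_image, th_image, h])
  · intro φ ih
    have aux : ∀ m m' : World, m.th = m'.th → ▵φ ∈ m → ▵φ ∈ m' := by
      intro m m' h hm
      refine mem_delta.2 fun n' hs => ?_
      obtain ⟨n, hs', hn⟩ := exists_succ_of_th (m := m) n'.isTheory_th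
        (fun α hα => hs.mem_th (h ▸ hα)) (fun α hα => h ▸ hs.neg_box_neg_mem_th hα)
      exact (ih n n' hn).1 (hs' φ hm)
    exact fun m m' h => ⟨aux m m' h, aux m' m h.symm⟩

end World

/-! ### Reduction to `B(ML)` -/

theorem IsBML.and {φ ψ : MTL} (h : IsBML φ) (h' : IsBML ψ) : IsBML (φ.and ψ) :=
  .snot (.mimp h (.snot h'))

theorem exists_bml_iff (φ : MTL) : ∃ ψ, IsBML ψ ∧ φ.iff ψ ∈ Thm := by
  by_contra! hcon
  have htop : IsBML (ML.var 0 ⇛ ML.var 0 : MTL) := .mimp (.ml _) (.ml _)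
  have hC : IsTeamTheory {θ | ∃ ψ, IsBML ψ ∧ (∀ n : World, φ ∈ n → ψ ∈ n) ∧
      ∀ n : World, ψ ∈ n → θ ∈ n} := by
    refine ⟨fun θ h => ⟨_, htop, by simp, fun n _ => h n⟩, ?_⟩
    rintro θ θ' ⟨ψ, hψ, h1, h2⟩ ⟨ψ', hψ', h1', h2'⟩
    refine ⟨_, hψ.and hψ', fun n hn => by simp [h1 n hn, h1' n hn], fun n hn => ?_⟩
    rw [World.mem_and] at hn
    exact World.mem_mimp.1 (h2' n hn.2) (h2 n hn.1)
  -- If `B(ML)` consequences of `φ` were inconsistent with `∼φ`, one of them would imply `φ` and so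
  -- be equivalent to it.
  obtain ⟨m, hm, hφm⟩ := hC.exists_world (.consequences (∼φ)) (by
    rintro χ hχ ⟨ψ, hψ, h1, h2⟩
    refine hcon ψ hψ (mem_thm_iff.2 fun n => World.mem_iff.2 ⟨h1 n, fun hn => ?_⟩)
    by_contra hc
    exact World.mem_snot.1 (h2 n hn) (hχ n (World.mem_snot.2 hc)))
  have hD : IsTeamTheory {θ | ∃ ψ, IsBML ψ ∧ ψ ∈ m ∧ ∀ n : World, ψ ∈ n → θ ∈ n} := by
    refine ⟨fun θ h => ⟨_, htop, by simp, fun n _ => h n⟩, ?_⟩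
    rintro θ θ' ⟨ψ, hψ, h1, h2⟩ ⟨ψ', hψ', h1', h2'⟩
    refine ⟨_, hψ.and hψ', by simp [h1, h1'], fun n hn => ?_⟩
    rw [World.mem_and] at hn
    exact World.mem_mimp.1 (h2' n hn.2) (h2 n hn.1)
  -- The `B(ML)` formulas of `m` are consistent with `φ`: otherwise `φ` would imply the strong
  -- negation of one of them, which `m` would then contain. So `m` and `m'` share their `ML`
  -- formulas but disagree on `φ`.
  obtain ⟨m', hφm', hm'⟩ := (IsTeamTheory.consequences φ).exists_world hD (by
    rintro χ ⟨ψ, hψ, h1, h2⟩ hχ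
    refine World.mem_snot.1 (hm (∼ψ) ⟨∼ψ, hψ.snot, fun n hn => ?_, fun _ h => h⟩) h1
    exact World.mem_snot.2 fun hc => World.mem_snot.1 (hχ n hn) (h2 n hc))
  have hth : m.th = m'.th := by
    ext α
    refine ⟨fun hα => hm' _ ⟨α, .ml α, hα, fun _ h => h⟩, fun hα => ?_⟩
    by_contra hc
    exact World.mem_snot.1 (hm' (∼(α : MTL)) ⟨_, .snot (.ml α), World.mem_snot.2 hc,
      fun _ h => h⟩) hα
  exact World.mem_snot.1 (hφm _ fun _ h => h)
    ((World.mem_iff_of_th_eq φ m m' hth).2 (hφm' _ fun _ h => h))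

theorem provEquiv_of_iff {φ ψ : MTL} (h : φ.iff ψ ∈ Thm) : HBoxLSM.ProvEquiv φ ψ := by
  have h1 : (φ ⇛ ψ) ∈ Thm := mem_thm_iff.2 fun m => by
    simpa using (World.mem_iff.1 (m.mem_of_thm h)).1
  have h2 : (ψ ⇛ φ) ∈ Thm := mem_thm_iff.2 fun m => by
    simpa using (World.mem_iff.1 (m.mem_of_thm h)).2
  exact ⟨derives_mp (.prem rfl) (derives_mono h1 (Set.empty_subset _)),
    derives_mp (.prem rfl) (derives_mono h2 (Set.empty_subset _))⟩

/-! ### Soundness -/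

section Soundness

variable {K : Kripke.{u}} {T : Set K.W} {φ ψ : MTL}

theorem sat_and : K.Sat (φ.and ψ) T ↔ K.Sat φ T ∧ K.Sat ψ T := by
  simp only [MTL.and, Kripke.Sat]; tauto

theorem sat_iff : K.Sat (φ.iff ψ) T ↔ (K.Sat φ T ↔ K.Sat ψ T) := by
  simp only [MTL.iff, sat_and, Kripke.Sat]; tauto

theorem sat_tensor :
    K.Sat (φ ⊗ ψ) T ↔ ∃ S U : Set K.W, S ∪ U = T ∧ K.Sat φ S ∧ K.Sat ψ U := by
  simp [MTL.tensor, Kripke.Sat]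

theorem sat_dia : K.Sat (◇φ) T ↔ ∃ T', K.IsSuccTeam T T' ∧ K.Sat φ T' := by
  simp [MTL.dia, Kripke.Sat]

theorem HBoxAxiom.sat (h : HBoxAxiom φ) : K.Sat φ T := by
  cases h <;> rw [Kripke.sat_toMTL] <;> intro w _ <;> simp only [Kripke.Holds]
  · tauto
  · tauto
  · tauto
  · exact fun h h' v hv => h v hv (h' v hv)

theorem LAxiom.sat (h : LAxiom φ) : K.Sat φ T := by
  cases h
  · simp only [Kripke.Sat]; tauto
  · simp only [Kripke.Sat]; tauto
  · simp only [Kripke.Sat]; tauto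
  · simp only [Kripke.Sat, Kripke.sat_toMTL, Kripke.Holds]
    exact fun h h' w hw => h w hw (h' w hw)

theorem SAxiom.sat (h : SAxiom φ) : K.Sat φ T := by
  cases h with
  | fTensor α β =>
    simp only [sat_iff, sat_tensor, Kripke.sat_toMTL, ML.or, Kripke.Holds]
    constructor
    · rintro ⟨S, U, rfl, hS, hU⟩ w (hw | hw) hn
      exacts [absurd (hS w hw) hn, hU w hw]
    · intro h
      refine ⟨{w ∈ T | K.Holds α w}, {w ∈ T | ¬ K.Holds α w}, ?_, fun w hw => hw.2,
        fun w hw => h w hw.1 hw.2⟩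
      ext w
      by_cases hw : K.Holds α w <;> simp [hw]
  | fLimp α φ =>
    simp only [Kripke.Sat, Kripke.sat_toMTL]
    rintro h S U rfl - w hw
    exact h w (.inr hw)
  | lax φ ψ θ =>
    simp only [Kripke.Sat]
    rintro h h' S U rfl -
    exact h' (S ∪ U) U (by rw [Set.union_assoc, Set.union_self]) h
  | ex φ ψ θ =>
    simp only [Kripke.Sat]
    rintro h S U rfl hS S' U' rfl hS'
    exact h S' (S ∪ U') (Set.union_left_comm _ _ _) hS' S U' rfl hS
  | contra φ ψ =>
    simp only [Kripke.Sat]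
    exact fun h S U hSU hS hU => h U S (by rw [Set.union_comm, hSU]) hU hS
  | dis φ ψ θ =>
    simp only [Kripke.Sat]
    exact fun h h' S U hSU hS => h S U hSU hS (h' S U hSU hS)

theorem isSuccTeam_image {T' : Set K.W} (h : K.IsSuccTeam T T') : K.IsSuccTeam T (K.image T) :=
  ⟨fun w hw => (h.1 w hw).imp fun _ hv => ⟨⟨w, hw, hv.2⟩, hv.2⟩, fun _ hv => hv⟩

theorem MAxiom.sat (h : MAxiom φ) : K.Sat φ T := by
  cases h with
  | lin φ => simp only [sat_iff, Kripke.Sat]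
  | fDia α =>
    simp only [sat_iff, sat_dia, Kripke.sat_toMTL, Kripke.Holds, not_forall, not_not]
    constructor
    · rintro ⟨T', h, h'⟩ w hw
      obtain ⟨v, hv, hR⟩ := h.1 w hw
      exact ⟨v, hR, h' v hv⟩
    · intro h
      refine ⟨{v ∈ K.image T | K.Holds α v}, ⟨fun w hw => ?_, fun v hv => hv.1⟩,
        fun v hv => hv.2⟩
      obtain ⟨v, hR, hv⟩ := h w hw
      exact ⟨v, ⟨⟨w, hw, hR⟩, hv⟩, hR⟩
  | dDiaTensor φ ψ =>
    simp only [sat_iff, sat_dia, sat_tensor]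
    constructor
    · rintro ⟨T', h, S, U, rfl, hS, hU⟩
      -- The team is split, possibly with overlap, by whether a point sees `S` or sees `U`.
      refine ⟨{w ∈ T | ∃ v ∈ S, K.R w v}, {w ∈ T | ∃ v ∈ U, K.R w v}, ?_,
        ⟨S, ⟨fun w hw => hw.2, fun v hv => ?_⟩, hS⟩, ⟨U, ⟨fun w hw => hw.2, fun v hv => ?_⟩, hU⟩⟩
      · ext w
        refine ⟨fun hw => hw.elim And.left And.left, fun hw => ?_⟩
        obtain ⟨v, hv | hv, hR⟩ := h.1 w hw
        exacts [.inl ⟨hw, v, hv, hR⟩, .inr ⟨hw, v, hv, hR⟩]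
      · obtain ⟨w, hw, hR⟩ := h.2 v (.inl hv)
        exact ⟨w, ⟨hw, v, hv, hR⟩, hR⟩
      · obtain ⟨w, hw, hR⟩ := h.2 v (.inr hv)
        exact ⟨w, ⟨hw, v, hv, hR⟩, hR⟩
    · rintro ⟨S, U, rfl, ⟨S', hS, hφ⟩, ⟨U', hU, hψ⟩⟩
      refine ⟨S' ∪ U', ⟨?_, ?_⟩, S', U', rfl, hφ, hψ⟩
      · rintro w (hw | hw)
        · exact (hS.1 w hw).imp fun v hv => ⟨.inl hv.1, hv.2⟩
        · exact (hU.1 w hw).imp fun v hv => ⟨.inr hv.1, hv.2⟩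
      · rintro v (hv | hv)
        · exact (hS.2 v hv).imp fun v hv => ⟨.inl hv.1, hv.2⟩
        · exact (hU.2 v hv).imp fun v hv => ⟨.inr hv.1, hv.2⟩
  | eBox α =>
    simp only [Kripke.Sat, Kripke.sat_toMTL]
    exact fun h T' hT' v hv => h v (hT'.2 v hv)
  | iBox φ ψ =>
    rw [Kripke.Sat, sat_dia]
    rintro ⟨T', hT', -⟩ h
    exact h _ (isSuccTeam_image hT')
  | disBox φ ψ => exact fun h h' => h h'
  | disDelta φ ψ => exact fun h h' T' hT' => h T' hT' (h' T' hT')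

/-- The team varies in the induction because the necessitation rules pass to other teams of the same
structure. -/
theorem Derives.sat {Φ : Set MTL} (h : HBoxLSM.Derives Φ φ)
    (hΦ : ∀ ψ ∈ Φ, ∀ T : Set K.W, K.Sat ψ T) (T : Set K.W) : K.Sat φ T := by
  induction h generalizing T with
  | prem h => exact hΦ _ h T
  | ax h =>
    rcases h with ((h | h) | h) | h
    exacts [HBoxAxiom.sat h, LAxiom.sat h, SAxiom.sat h, MAxiom.sat h]
  | rule h _ ih =>
    rcases h with ((⟨α, β, h⟩ | ⟨φ, ψ, h⟩) | h) | h
    · obtain ⟨rfl, rfl⟩ := Prod.mk.inj h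
      have h1 := ih α (by simp) hΦ T
      have h2 := ih (α.imp β : ML) (by simp) hΦ T
      rw [Kripke.sat_toMTL] at *
      exact fun w hw => h2 w hw (h1 w hw)
    · obtain ⟨rfl, rfl⟩ := Prod.mk.inj h
      exact ih (φ ⇛ _) (by simp) hΦ T (ih φ (by simp) hΦ T)
    · exact h.elim
    · exact h.elim
  | thmRule h _ ih =>
    have hE : ∀ ψ ∈ (∅ : Set MTL), ∀ T : Set K.W, K.Sat ψ T := fun ψ hψ => hψ.elim
    rcases h with ((⟨α, h⟩ | h) | ⟨φ, ψ, h⟩) | ⟨φ, h⟩ | ⟨φ, h⟩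
    · obtain ⟨rfl, rfl⟩ := Prod.mk.inj h
      exact ih α (by simp) hE (K.image T)
    · exact h.elim
    · obtain ⟨rfl, rfl⟩ := Prod.mk.inj h
      exact fun S U _ _ => ih φ (by simp) hE U
    · obtain ⟨rfl, rfl⟩ := Prod.mk.inj h
      exact ih φ (by simp) hE (K.image T)
    · obtain ⟨rfl, rfl⟩ := Prod.mk.inj h
      exact fun T' _ => ih φ (by simp) hE T'

end Soundness

theorem mod_eq_of_iff {φ ψ : MTL} (h : φ.iff ψ ∈ Thm) : Mod.{u} φ = Mod.{u} ψ :=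
  Set.ext fun A => sat_iff.1 (Derives.sat h (fun _ h => h.elim) A.2)

end TeamLogic

theorem mainTheorem8 :
    (∀ φ : TeamLogic.MTL, ∃ φ' ∈ TeamLogic.BML,
      TeamLogic.HBoxLSM.ProvEquiv φ φ' ∧ TeamLogic.Mod.{u} φ = TeamLogic.Mod.{u} φ') ∧
    TeamLogic.ExprEquiv.{u} Set.univ TeamLogic.BML := by
  refine ⟨fun φ => ?_, fun φ _ => ?_, fun φ _ => ⟨φ, trivial, rfl⟩⟩
  all_goals obtain ⟨ψ, hψ, h⟩ := TeamLogic.exists_bml_iff φ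
  · exact ⟨ψ, hψ, TeamLogic.provEquiv_of_iff h, TeamLogic.mod_eq_of_iff h⟩
  · exact ⟨ψ, hψ, TeamLogic.mod_eq_of_iff h⟩
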